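/- Let $N_t\ge 1$, $N_r>1$ be integers and let $\lambda_1,\lambda_2,\lambda_3,\lambda_4,P_S,P_J,N_D,N_E>0$ and $0\le\rho\le 1$ be real numbers. Let $h_{sd}\in\mathbb{C}$, the row vector $\mathbf h_{ed}\in\mathbb{C}^{1\times N_t}$, the column vector $\mathbf h_{se}\in\mathbb{C}^{N_r}$ and the matrix $\mathbf H_{ee}\in\mathbb{C}^{N_r\times N_t}$ be random, with all their entries mutually independent zero-mean circularly symmetric complex Gaussian random variables, of variance $\lambda_1$ for $h_{sd}$, $\lambda_3$ for the entries of $\mathbf h_{ed}$, $\lambda_2$ for those of $\mathbf h_{se}$ and $\lambda_4$ for those of $\mathbf H_{ee}$. For beamforming vectors $\mathbf w_t\in\mathbb{C}^{N_t}$, $\mathbf w_r\in\mathbb{C}^{N_r}$ and jamming power $P_J$ let $$\mathrm{SINR}_D=\frac{P_S|h_{sd}|^2}{P_J|\mathbf h_{ed}\mathbf w_t|^2+N_D},\qquad \mathrm{SINR}_E=\frac{P_S|\mathbf w_r^\dagger\mathbf h_{se}|^2}{\rho P_J|\mathbf w_r^\dagger\mathbf H_{ee}\mathbf w_t|^2+N_E},$$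 and let $X=1$ if $\mathrm{SINR}_E\ge\mathrm{SINR}_D$ and $X=0$ otherwise. In the MRT/RZF scheme, $\mathbf w_t=\mathbf h_{ed}^\dagger/\|\mathbf h_{ed}\|$ and $\mathbf w_r$ maximizes $|\mathbf w_r^\dagger\mathbf h_{se}|^2$ subject to $\mathbf w_r^\dagger\mathbf H_{ee}\mathbf h_{ed}^\dagger=0$ and $\|\mathbf w_r\|=1$; the maximizer used is $$\mathbf w_r=\frac{\mathbf\Pi_2\mathbf h_{se}}{\|\mathbf\Pi_2\mathbf h_{se}\|},\qquad \mathbf\Pi_2=\mathbf I_{N_r}-\frac{\mathbf H_{ee}\mathbf h_{ed}^\dagger\mathbf h_{ed}\mathbf H_{ee}^\dagger}{\|\mathbf H_{ee}\mathbf h_{ed}^\dagger\|^2}.$$ Then, both for this closed-form $\mathbf w_r$ and for every choice of $\mathbf w_r$ that almost surely solves the stated maximization problem, $$E\{X\}=1-\sum_{k=0}^{N_t-1}\frac{(-1)^k}{k!\,(N_t-k-1)!}\left(\frac{\lambda_1N_E}{\lambda_2\lambda_3P_J}\right)^{N_r-1}\beta^k e^{\beta}\,\Gamma(N_t-N_r-k+1,\beta),\qquad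 \beta=\frac{N_D}{\lambda_3P_J}+\frac{\lambda_1N_E}{\lambda_2\lambda_3P_J},$$ where $\Gamma(\alpha,x)=\int_x^\infty t^{\alpha-1}e^{-t}\,dt$ is the upper incomplete gamma function. -/

import Mathlib

open MeasureTheory ProbabilityTheory
open scoped Matrix Nat

/-- The upper incomplete gamma function `Γ(s, x) = ∫_x^∞ t^(s-1) e^(-t) dt`,
for real `s` of either sign and `x > 0`. -/
noncomputable def upperGamma (s x : ℝ) : ℝ :=
  ∫ t in Set.Ioi x, t ^ (s - 1) * Real.exp (-t)

/-- The law on `ℂ` of a zero-mean circularly symmetric complex Gaussian variable `h` with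
variance `E|h|² = v`: real and imaginary part are independent `N(0, v / 2)`. -/
noncomputable def complexNormal (v : ℝ) : Measure ℂ :=
  ((gaussianReal 0 (v / 2).toNNReal).prod (gaussianReal 0 (v / 2).toNNReal)).map
    (fun p : ℝ × ℝ => (p.1 : ℂ) + (p.2 : ℂ) * Complex.I)

/-- The Euclidean norm of a complex vector. -/
noncomputable def vecNorm {n : ℕ} (v : Fin n → ℂ) : ℝ := ‖WithLp.toLp 2 v‖

/-- The indices of all scalar channel coefficients: that of `h_sd`, those of `h_ed`, of `h_se`
and of `H_ee`. -/
abbrev ChannelIndex (Nt Nr : ℕ) : Type := Unit ⊕ Fin Nt ⊕ Fin Nr ⊕ (Fin Nr × Fin Nt)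

/-- The family of all scalar channel coefficients, as random variables. -/
def channelCoeff {Ω : Type*} {Nt Nr : ℕ} (hsd : Ω → ℂ) (hed : Ω → Fin Nt → ℂ)
    (hse : Ω → Fin Nr → ℂ) (Hee : Ω → Matrix (Fin Nr) (Fin Nt) ℂ) :
    ChannelIndex Nt Nr → Ω → ℂ
  | .inl _ => hsd
  | .inr (.inl j) => fun ω => hed ω j
  | .inr (.inr (.inl i)) => fun ω => hse ω i
  | .inr (.inr (.inr (i, j))) => fun ω => Hee ω i j

/-- `SINR_D = P_S |h_sd|² / (p_d |h_ed w_t|² + N_D)`. -/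
noncomputable def sinrD {Nt : ℕ} (PS pd ND : ℝ) (hsd : ℂ) (hed wt : Fin Nt → ℂ) : ℝ :=
  PS * ‖hsd‖ ^ 2 / (pd * ‖hed ⬝ᵥ wt‖ ^ 2 + ND)

/-- `SINR_E = P_S |w_r† h_se|² / (ρ p_d |w_r† H_ee w_t|² + N_E)`. -/
noncomputable def sinrE {Nt Nr : ℕ} (PS pd ρ NE : ℝ) (hse : Fin Nr → ℂ)
    (Hee : Matrix (Fin Nr) (Fin Nt) ℂ) (wt : Fin Nt → ℂ) (wr : Fin Nr → ℂ) : ℝ :=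
  PS * ‖star wr ⬝ᵥ hse‖ ^ 2 / (ρ * pd * ‖star wr ⬝ᵥ (Hee *ᵥ wt)‖ ^ 2 + NE)

/-- The indicator `X` of successful eavesdropping: `1` if `SINR_E ≥ SINR_D`, `0` otherwise. -/
noncomputable def eavesdropX {Nt Nr : ℕ} (PS pd ρ ND NE : ℝ) (hsd : ℂ) (hed : Fin Nt → ℂ)
    (hse : Fin Nr → ℂ) (Hee : Matrix (Fin Nr) (Fin Nt) ℂ) (wt : Fin Nt → ℂ)
    (wr : Fin Nr → ℂ) : ℝ :=
  if sinrE PS pd ρ NE hse Hee wt wr ≥ sinrD PS pd ND hsd hed wt then 1 else 0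

/-- Maximum ratio transmission: `w_t = h_ed† / ‖h_ed‖`. -/
noncomputable def mrt {Nt : ℕ} (hed : Fin Nt → ℂ) : Fin Nt → ℂ :=
  ((vecNorm hed)⁻¹ : ℂ) • star hed

/-- The receive vectors allowed to receive zero-forcing:
`w_r† H_ee h_ed† = 0` and `‖w_r‖ = 1`. -/
def rzfFeasible {Nt Nr : ℕ} (hed : Fin Nt → ℂ) (Hee : Matrix (Fin Nr) (Fin Nt) ℂ) :
    Set (Fin Nr → ℂ) :=
  {w | star w ⬝ᵥ (Hee *ᵥ star hed) = 0 ∧ vecNorm w = 1}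

/-- `w` is an optimal zero-forcing receive vector: it maximizes `|w_r† h_se|²` over the
feasible vectors. -/
def IsRZF {Nt Nr : ℕ} (hed : Fin Nt → ℂ) (hse : Fin Nr → ℂ)
    (Hee : Matrix (Fin Nr) (Fin Nt) ℂ) (w : Fin Nr → ℂ) : Prop :=
  w ∈ rzfFeasible hed Hee ∧ IsMaxOn (fun v => ‖star v ⬝ᵥ hse‖ ^ 2) (rzfFeasible hed Hee) w

/-- `Π₂ = I - H_ee h_ed† h_ed H_ee† / ‖H_ee h_ed†‖²`. -/
noncomputable def rzfProj {Nt Nr : ℕ} (hed : Fin Nt → ℂ) (Hee : Matrix (Fin Nr) (Fin Nt) ℂ) :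
    Matrix (Fin Nr) (Fin Nr) ℂ :=
  1 - (((vecNorm (Hee *ᵥ star hed)) ^ 2)⁻¹ : ℂ) •
    Matrix.vecMulVec (Hee *ᵥ star hed) (hed ᵥ* Heeᴴ)

/-- The closed-form zero-forcing receive vector `w_r = Π₂ h_se / ‖Π₂ h_se‖`. -/
noncomputable def rzf {Nt Nr : ℕ} (hed : Fin Nt → ℂ) (hse : Fin Nr → ℂ)
    (Hee : Matrix (Fin Nr) (Fin Nt) ℂ) : Fin Nr → ℂ :=
  ((vecNorm (rzfProj hed Hee *ᵥ hse))⁻¹ : ℂ) • (rzfProj hed Hee *ᵥ hse)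

/-- The closed form for the eavesdropping non-outage probability of the MRT/RZF scheme. -/
noncomputable def mrtRzfValue (Nt Nr : ℕ) (lam1 lam2 lam3 PJ ND NE : ℝ) : ℝ :=
  1 - ∑ k ∈ Finset.range Nt,
    (-1 : ℝ) ^ k / ((k ! : ℝ) * ((Nt - k - 1)! : ℝ)) *
      (lam1 * NE / (lam2 * lam3 * PJ)) ^ (Nr - 1) *
      (ND / (lam3 * PJ) + lam1 * NE / (lam2 * lam3 * PJ)) ^ k *
      Real.exp (ND / (lam3 * PJ) + lam1 * NE / (lam2 * lam3 * PJ)) *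
      upperGamma ((Nt : ℝ) - (Nr : ℝ) - (k : ℝ) + 1)
        (ND / (lam3 * PJ) + lam1 * NE / (lam2 * lam3 * PJ))

/-! Zero-forcing removes the jamming term at the eavesdropper, so `X = 0` exactly when `|h_sd|²`
exceeds `S (P_J ‖h_ed‖² + N_D) / N_E`, where `S = ‖Π₂ h_se‖²`. This gain is shared by the closed
form and by every maximizer (`rzf_gain`, `IsRZF.gain`), so one computation covers both claims. Since
`|h_sd|²` is exponential (`complexNormal_tail`), integrating it out turns `P(X = 0)` into a Laplace
transform of `S` at a point depending on `h_ed`. Given `h_ed` and `H_ee`, `Π₂` almost surely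
projects onto a fixed hyperplane of dimension `N_r - 1`, and `lintegral_exp_neg_mul_complProj` gives
`(1 + λ₂ s)^(-(N_r - 1))`, whatever the hyperplane. What remains is an inverse moment of `‖h_ed‖² /
λ₃ + β`. By `lintegral_inv_vecNorm_add_pow` it equals that of a shifted Gamma variable of shape
`N_t`; translating by `β` and expanding binomially (`lintegral_gamma_inv_pow`) yields the incomplete
gamma functions. -/

/-! ### Densities of finite product measures. -/

theorem lintegral_fin_prod_eq_prod {n : ℕ} {E : Fin n → Type*}
    {mE : ∀ i, MeasurableSpace (E i)} (μ : ∀ i, Measure (E i)) [∀ i, SigmaFinite (μ i)]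
    (f : ∀ i, E i → ENNReal) (hf : ∀ i, Measurable (f i)) :
    ∫⁻ x, ∏ i, f i (x i) ∂(Measure.pi μ) = ∏ i, ∫⁻ x, f i x ∂(μ i) := by
  induction n with
  | zero => simp [Measure.pi_empty_univ]
  | succ n ih =>
    rw [← (measurePreserving_piFinSuccAbove μ 0).symm.lintegral_comp_emb
      (MeasurableEquiv.measurableEmbedding _)]
    rw [Fin.prod_univ_succ]
    refine (lintegral_congr fun a => ?_).trans ((lintegral_prod_mul (μ := μ 0)
      (ν := Measure.pi fun j : Fin n => μ j.succ) (f := f 0)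
      (g := fun x : ∀ j : Fin n, E j.succ => ∏ j, f j.succ (x j)) (hf 0).aemeasurable
      (Finset.measurable_fun_prod _ fun j _ => (hf _).comp (measurable_pi_apply j)).aemeasurable).trans ?_)
    · rw [Fin.prod_univ_succ]
      rfl
    congr 1
    exact ih (fun i => μ i.succ) (fun i => f i.succ) fun i => hf _

theorem pi_withDensity {n : ℕ} {E : Type*} [MeasurableSpace E] (μ : Measure E) [SigmaFinite μ]
    (f : E → ENNReal) (hf : Measurable f) [SigmaFinite (μ.withDensity f)] :
    Measure.pi (fun _ : Fin n => μ.withDensity f) =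
      (Measure.pi fun _ : Fin n => μ).withDensity fun x => ∏ i, f (x i) := by
  refine Measure.pi_eq fun s hs => ?_
  rw [withDensity_apply _ (MeasurableSet.univ_pi hs),
    ← lintegral_indicator (MeasurableSet.univ_pi hs)]
  have h : (Set.univ.pi s).indicator (fun x : Fin n → E => ∏ i, f (x i)) =
      fun x => ∏ i, (s i).indicator f (x i) := by
    ext x
    by_cases hx : x ∈ Set.univ.pi s
    · rw [Set.indicator_of_mem hx]
      exact Finset.prod_congr rfl fun i _ => (Set.indicator_of_mem (hx i trivial) f).symm
    · rw [Set.indicator_of_notMem hx]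
      simp only [Set.mem_pi, Set.mem_univ, true_imp_iff, not_forall] at hx
      obtain ⟨i, hi⟩ := hx
      exact (Finset.prod_eq_zero (Finset.mem_univ i) (Set.indicator_of_notMem hi f)).symm
  rw [h, lintegral_fin_prod_eq_prod _ _ fun i => hf.indicator (hs i)]
  exact Finset.prod_congr rfl fun i _ => by
    rw [lintegral_indicator (hs i), withDensity_apply _ (hs i)]

/-! ### The complex Gaussian law: density and tail. -/

instance (v : ℝ) : IsProbabilityMeasure (complexNormal v) :=
  Measure.isProbabilityMeasure_map (by fun_prop)

/-- The density of `complexNormal v`. -/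
noncomputable def complexNormalPDF (v : ℝ) (z : ℂ) : ENNReal :=
  ENNReal.ofReal ((Real.pi * v)⁻¹ * Real.exp (-‖z‖ ^ 2 / v))

theorem measurable_complexNormalPDF (v : ℝ) : Measurable (complexNormalPDF v) := by
  unfold complexNormalPDF; fun_prop

theorem complexNormal_eq_withDensity {v : ℝ} (hv : 0 < v) :
    complexNormal v = volume.withDensity (complexNormalPDF v) := by
  have h0 : (v / 2).toNNReal ≠ 0 := by simpa using hv
  have hf : (fun p : ℝ × ℝ => (p.1 : ℂ) + (p.2 : ℂ) * Complex.I) =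
      Complex.measurableEquivRealProd.symm := by
    ext1 p
    exact (Complex.mk_eq_add_mul_I p.1 p.2).symm
  unfold complexNormal
  rw [gaussianReal_of_var_ne_zero _ h0, prod_withDensity (measurable_gaussianPDF _ _)
    (measurable_gaussianPDF _ _), hf]
  ext s hs
  rw [MeasurableEquiv.map_apply, withDensity_apply _ hs,
    withDensity_apply _ (Complex.measurableEquivRealProd.symm.measurable hs),
    ← Complex.volume_preserving_equiv_real_prod.symm.setLIntegral_comp_preimage hs
      (measurable_complexNormalPDF v)]
  refine lintegral_congr fun p => ?_
  have hp : ‖Complex.measurableEquivRealProd.symm p‖ ^ 2 = p.1 ^ 2 + p.2 ^ 2 := by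
    rw [← hf, Complex.norm_add_mul_I, Real.sq_sqrt (by positivity)]
  rw [gaussianPDF, gaussianPDF, ← ENNReal.ofReal_mul (gaussianPDFReal_nonneg _ _ _),
    complexNormalPDF, hp]
  congr 1
  simp only [gaussianPDFReal, Real.coe_toNNReal _ (by positivity : 0 ≤ v / 2), sub_zero]
  rw [mul_mul_mul_comm, ← Real.exp_add, ← mul_inv, Real.mul_self_sqrt (by positivity)]
  congr 2
  · field_simp
  · field_simp
    ring

theorem complexNormal_singleton {v : ℝ} (hv : 0 < v) (z : ℂ) : complexNormal v {z} = 0 := by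
  rw [complexNormal_eq_withDensity hv]
  exact withDensity_absolutelyContinuous _ _ (measure_singleton z)

/-- In polar coordinates the Jacobian `r` makes the radial density an exact derivative, so `‖z‖²` is
exponential with mean `v`. -/
theorem complexNormal_tail {v t : ℝ} (hv : 0 < v) (ht : 0 ≤ t) :
    complexNormal v {z | t < ‖z‖ ^ 2} = ENNReal.ofReal (Real.exp (-t / v)) := by
  have hm : MeasurableSet {z : ℂ | t < ‖z‖ ^ 2} := measurableSet_lt (by fun_prop) (by fun_prop)
  rw [complexNormal_eq_withDensity hv, withDensity_apply _ hm, ← lintegral_indicator hm,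
    ← Complex.lintegral_comp_polarCoord_symm, polarCoord_target]
  set g : ℝ → ENNReal := (Set.Ioi (√t)).indicator fun r =>
    ENNReal.ofReal (r * ((Real.pi * v)⁻¹ * Real.exp (-r ^ 2 / v))) with hg
  have hgm : Measurable g := Measurable.indicator (by fun_prop) measurableSet_Ioi
  have h1 : ∀ p ∈ Set.Ioi (0 : ℝ) ×ˢ Set.Ioo (-Real.pi) Real.pi,
      ENNReal.ofReal p.1 • ({z : ℂ | t < ‖z‖ ^ 2}.indicator (complexNormalPDF v))
        (Complex.polarCoord.symm p) = g p.1 := by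
    rintro ⟨r, θ⟩ ⟨hr, -⟩
    have hr : 0 < r := hr
    have hiff : Complex.polarCoord.symm (r, θ) ∈ {z : ℂ | t < ‖z‖ ^ 2} ↔ r ∈ Set.Ioi (√t) := by
      rw [Set.mem_ofPred_eq, Complex.norm_polarCoord_symm, Set.mem_Ioi, sq_abs,
        Real.sqrt_lt ht hr.le]
    by_cases h : r ∈ Set.Ioi (√t)
    · rw [Set.indicator_of_mem (hiff.2 h), hg]
      simp only [Set.indicator_of_mem h]
      rw [complexNormalPDF, Complex.norm_polarCoord_symm, sq_abs, smul_eq_mul,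
        ← ENNReal.ofReal_mul hr.le]
    · rw [Set.indicator_of_notMem (fun h' => h (hiff.1 h')), hg]
      simp only [Set.indicator_of_notMem h, smul_zero]
  rw [setLIntegral_congr_fun (measurableSet_Ioi.prod measurableSet_Ioo) h1,
    Measure.volume_eq_prod, ← Measure.prod_restrict]
  have h2 := lintegral_prod_mul (μ := volume.restrict (Set.Ioi (0 : ℝ)))
    (ν := volume.restrict (Set.Ioo (-Real.pi) Real.pi)) (f := g) (g := fun _ => 1)
    hgm.aemeasurable aemeasurable_const
  simp only [mul_one] at h2
  rw [h2, hg, setLIntegral_indicator measurableSet_Ioi, lintegral_one,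
    Measure.restrict_apply_univ, Real.volume_Ioo,
    Set.inter_eq_left.2 (Set.Ioi_subset_Ioi (Real.sqrt_nonneg t))]
  -- The factor `(2π)⁻¹` of this primitive cancels the length of the angular interval.
  have hd : ∀ x ∈ Set.Ici (√t), HasDerivAt
      (fun r => -((2 * Real.pi)⁻¹ * Real.exp (-r ^ 2 / v)))
      (x * ((Real.pi * v)⁻¹ * Real.exp (-x ^ 2 / v))) x := by
    intro x _
    have := (((((hasDerivAt_id x).pow 2).neg).div_const v).exp.const_mul (2 * Real.pi)⁻¹).neg
    refine this.congr_deriv ?_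
    simp only [Pi.pow_apply, Pi.neg_apply, id]
    field_simp
    simp only [Nat.cast_ofNat]
    ring_nf
  have hpos : ∀ x ∈ Set.Ioi (√t), 0 ≤ x * ((Real.pi * v)⁻¹ * Real.exp (-x ^ 2 / v)) := by
    intro x hx
    have : 0 ≤ x := (Real.sqrt_nonneg t).trans (le_of_lt hx)
    positivity
  have hlim : Filter.Tendsto (fun r => -((2 * Real.pi)⁻¹ * Real.exp (-r ^ 2 / v)))
      Filter.atTop (nhds 0) := by
    have h3 : Filter.Tendsto (fun r : ℝ => -r ^ 2 / v) Filter.atTop Filter.atBot :=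
      (Filter.tendsto_neg_atTop_atBot.comp
        (Filter.tendsto_pow_atTop two_ne_zero)).atBot_div_const hv
    simpa using ((Real.tendsto_exp_atBot.comp h3).const_mul (2 * Real.pi)⁻¹).neg
  rw [← ofReal_integral_eq_lintegral_ofReal
    (integrableOn_Ioi_deriv_of_nonneg' hd hpos hlim)
    ((ae_restrict_iff' measurableSet_Ioi).2 (ae_of_all _ hpos)),
    integral_Ioi_of_hasDerivAt_of_nonneg' hd hpos hlim, Real.sq_sqrt ht,
    ← ENNReal.ofReal_mul (by simp; positivity)]
  congr 1
  have := Real.pi_pos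
  field_simp
  ring

/-! ### Gaussian Laplace transforms by linear change of variables. -/

theorem prod_complexNormalPDF {n : ℕ} {v : ℝ} (hv : 0 < v) (h : Fin n → ℂ) :
    ∏ i, complexNormalPDF v (h i) =
      ENNReal.ofReal (((Real.pi * v)⁻¹) ^ n * Real.exp (-(∑ i, ‖h i‖ ^ 2) / v)) := by
  unfold complexNormalPDF
  rw [← ENNReal.ofReal_prod_of_nonneg fun i _ => by positivity, Finset.prod_mul_distrib,
    ← Real.exp_sum, Finset.prod_const, Finset.card_univ, Fintype.card_fin,
    ← Finset.sum_div, Finset.sum_neg_distrib]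

/-- A Gaussian Laplace transform of a real quadratic form, through a linear change of variables
that absorbs the form into the density. -/
theorem lintegral_exp_neg_pi_complexNormal {n : ℕ} {v : ℝ} (hv : 0 < v)
    (T : (Fin n → ℂ) →ₗ[ℝ] (Fin n → ℂ)) (hT : LinearMap.det T ≠ 0) (q : (Fin n → ℂ) → ℝ)
    (hq : ∀ h, ∑ i, ‖T h i‖ ^ 2 = ∑ i, ‖h i‖ ^ 2 + v * q h) :
    ∫⁻ h, ENNReal.ofReal (Real.exp (-q h)) ∂(Measure.pi fun _ : Fin n => complexNormal v) =
      ENNReal.ofReal |(LinearMap.det T)⁻¹| := by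
  have hpi : (Measure.pi fun _ : Fin n => complexNormal v) =
      (volume : Measure (Fin n → ℂ)).withDensity fun x => ∏ i, complexNormalPDF v (x i) := by
    have hc := complexNormal_eq_withDensity hv
    have : SigmaFinite ((volume : Measure ℂ).withDensity (complexNormalPDF v)) := by
      rw [← hc]; infer_instance
    rw [hc, pi_withDensity _ _ (measurable_complexNormalPDF v)]; rfl
  have hm : Measurable fun x : Fin n → ℂ => ∏ i, complexNormalPDF v (x i) :=
    Finset.measurable_fun_prod _ fun i _ =>
      (measurable_complexNormalPDF v).comp (measurable_pi_apply i)
  have hTm : Measurable T := (LinearMap.continuous_of_finiteDimensional T).measurable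
  have h1 : ∫⁻ x : Fin n → ℂ, ∏ i, complexNormalPDF v (x i) = 1 := by
    have : (Measure.pi fun _ : Fin n => complexNormal v) Set.univ = 1 := measure_univ
    rwa [hpi, withDensity_apply _ MeasurableSet.univ, Measure.restrict_univ] at this
  -- Measurability of `q` comes for free: `hq` expresses it through `T`.
  have hqm : Measurable q := by
    have : q = fun h => (∑ i, ‖T h i‖ ^ 2 - ∑ i, ‖h i‖ ^ 2) / v := by
      ext h; rw [hq]; field_simp; ring
    rw [this]
    have : ∀ i, Measurable fun h => T h i := fun i => (measurable_pi_apply i).comp hTm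
    fun_prop
  rw [hpi, lintegral_withDensity_eq_lintegral_mul _ hm (by fun_prop)]
  -- By `hq`, the Gaussian density at `T x` is the density at `x` times `exp (-q x)`.
  calc _ = ∫⁻ x, ∏ i, complexNormalPDF v (T x i) := by
        refine lintegral_congr fun x => ?_
        rw [Pi.mul_apply, prod_complexNormalPDF hv, prod_complexNormalPDF hv,
          ← ENNReal.ofReal_mul (by positivity), mul_assoc, ← Real.exp_add, hq]
        congr 3
        field_simp
        ring
    _ = ∫⁻ y, ∏ i, complexNormalPDF v (y i) ∂(Measure.map T volume) :=
        (lintegral_map hm hTm).symm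
    _ = _ := by
        rw [Measure.map_linearMap_addHaar_eq_smul_addHaar _ hT, lintegral_smul_measure, h1,
          smul_eq_mul, mul_one]

/-! ### Euclidean norms, orthogonal projections and the stretch map. -/

theorem vecNorm_sq {n : ℕ} (v : Fin n → ℂ) : vecNorm v ^ 2 = ∑ i, ‖v i‖ ^ 2 := by
  rw [vecNorm, EuclideanSpace.norm_sq_eq]

theorem vecNorm_nonneg {n : ℕ} (v : Fin n → ℂ) : 0 ≤ vecNorm v := norm_nonneg _

theorem vecNorm_eq_zero {n : ℕ} {v : Fin n → ℂ} : vecNorm v = 0 ↔ v = 0 := by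
  rw [vecNorm, norm_eq_zero, WithLp.toLp_eq_zero]

theorem vecNorm_smul {n : ℕ} (c : ℂ) (v : Fin n → ℂ) : vecNorm (c • v) = ‖c‖ * vecNorm v := by
  rw [vecNorm, WithLp.toLp_smul, norm_smul, vecNorm]

theorem star_dotProduct_self {n : ℕ} (v : Fin n → ℂ) : star v ⬝ᵥ v = (vecNorm v : ℂ) ^ 2 := by
  rw [← Complex.ofReal_pow, vecNorm_sq, dotProduct]
  push_cast
  exact Finset.sum_congr rfl fun i _ => Complex.conj_mul' _

theorem norm_star_dotProduct_le {n : ℕ} (v w : Fin n → ℂ) :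
    ‖star v ⬝ᵥ w‖ ≤ vecNorm v * vecNorm w := by
  have h := norm_inner_le_norm (𝕜 := ℂ) (WithLp.toLp 2 v) (WithLp.toLp 2 w)
  rwa [EuclideanSpace.inner_toLp_toLp, dotProduct_comm] at h

theorem vecNorm_add_sq {n : ℕ} {v w : Fin n → ℂ} (h : star v ⬝ᵥ w = 0) :
    vecNorm (v + w) ^ 2 = vecNorm v ^ 2 + vecNorm w ^ 2 := by
  have h' : inner ℂ (WithLp.toLp 2 v) (WithLp.toLp 2 w) = 0 := by
    rw [EuclideanSpace.inner_toLp_toLp, dotProduct_comm, h]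
  have := norm_add_sq_eq_norm_sq_add_norm_sq_of_inner_eq_zero _ _ h'
  rw [vecNorm, vecNorm, vecNorm, WithLp.toLp_add, sq, sq, sq, this]

/-- The orthogonal projection onto the complement of the line spanned by `u`
(the identity if `u = 0`). -/
noncomputable def complProj {n : ℕ} (u : Fin n → ℂ) : Matrix (Fin n) (Fin n) ℂ :=
  1 - ((vecNorm u ^ 2)⁻¹ : ℂ) • Matrix.vecMulVec u (star u)

theorem rzfProj_eq_complProj {Nt Nr : ℕ} (hed : Fin Nt → ℂ) (Hee : Matrix (Fin Nr) (Fin Nt) ℂ) :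
    rzfProj hed Hee = complProj (Hee *ᵥ star hed) := by
  rw [rzfProj, complProj, Matrix.star_mulVec, star_star]

theorem complProj_mulVec {n : ℕ} (u h : Fin n → ℂ) :
    complProj u *ᵥ h = h - (((vecNorm u ^ 2)⁻¹ : ℂ) * (star u ⬝ᵥ h)) • u := by
  rw [complProj, Matrix.sub_mulVec, Matrix.one_mulVec, Matrix.smul_mulVec,
    Matrix.vecMulVec_mulVec, op_smul_eq_smul, smul_smul]

theorem star_dotProduct_complProj_mulVec {n : ℕ} (u h : Fin n → ℂ) :
    star u ⬝ᵥ (complProj u *ᵥ h) = 0 := by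
  rw [complProj_mulVec, dotProduct_sub, dotProduct_smul, star_dotProduct_self, smul_eq_mul]
  by_cases hu : u = 0
  · simp [hu]
  · have : (vecNorm u : ℂ) ≠ 0 := by exact_mod_cast mt vecNorm_eq_zero.1 hu
    field_simp
    ring

theorem star_dotProduct_comm_eq_zero {n : ℕ} {v w : Fin n → ℂ} (h : star v ⬝ᵥ w = 0) :
    star w ⬝ᵥ v = 0 := by
  rw [Matrix.star_dotProduct, h, star_zero]

theorem star_dotProduct_complProj_of_orthogonal {n : ℕ} {u v : Fin n → ℂ} (h : Fin n → ℂ)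
    (hv : star v ⬝ᵥ u = 0) : star v ⬝ᵥ (complProj u *ᵥ h) = star v ⬝ᵥ h := by
  rw [complProj_mulVec, dotProduct_sub, dotProduct_smul, hv, smul_zero, sub_zero]

/-- Multiplication by `1` on the line spanned by `u`, by `c` on its orthogonal complement. -/
noncomputable def stretch {n : ℕ} (c : ℝ) (u : Fin n → ℂ) : Matrix (Fin n) (Fin n) ℂ :=
  (c : ℂ) • complProj u + (1 - complProj u)

/-- Pythagoras for `h = p + (h - p)`, where only the projected part `p` is scaled. With `c² = 1 + v
s` the excess is the quadratic form to be absorbed into the Gaussian density. -/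
theorem vecNorm_stretch {n : ℕ} (c : ℝ) (u h : Fin n → ℂ) :
    vecNorm (stretch c u *ᵥ h) ^ 2 =
      vecNorm h ^ 2 + (c ^ 2 - 1) * vecNorm (complProj u *ᵥ h) ^ 2 := by
  set p := complProj u *ᵥ h with hp
  set a := ((vecNorm u ^ 2)⁻¹ : ℂ) * (star u ⬝ᵥ h) with ha
  have h1 : h - p = a • u := by rw [hp, complProj_mulVec]; simp [ha]
  have hort : ∀ d : ℂ, star (d • p) ⬝ᵥ (h - p) = 0 := fun d => by
    rw [h1, star_smul, smul_dotProduct, dotProduct_smul,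
      star_dotProduct_comm_eq_zero (star_dotProduct_complProj_mulVec u h), smul_zero, smul_zero]
  have h2 : stretch c u *ᵥ h = (c : ℂ) • p + (h - p) := by
    rw [stretch, Matrix.add_mulVec, Matrix.sub_mulVec, Matrix.smul_mulVec, Matrix.one_mulVec]
  have h3 : vecNorm h ^ 2 = vecNorm p ^ 2 + vecNorm (h - p) ^ 2 := by
    have := vecNorm_add_sq (hort 1)
    rwa [one_smul, add_sub_cancel] at this
  rw [h2, vecNorm_add_sq (hort c), h3, vecNorm_smul, Complex.norm_real, mul_pow,
    Real.norm_eq_abs, sq_abs]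
  ring

/-- The stretch is `c` times a rank-one perturbation of the identity, so the matrix determinant
lemma applies: the line of `u` contributes `1`, its complement `c ^ n`. -/
theorem det_stretch {n : ℕ} {c : ℝ} (hc : c ≠ 0) {u : Fin (n + 1) → ℂ} (hu : u ≠ 0) :
    (stretch c u).det = (c : ℂ) ^ n := by
  have hc' : (c : ℂ) ≠ 0 := by exact_mod_cast hc
  have hu' : (vecNorm u : ℂ) ≠ 0 := by exact_mod_cast mt vecNorm_eq_zero.1 hu
  have h : stretch c u = (c : ℂ) • (1 + Matrix.replicateCol Unit
      (((1 - c) / c * ((vecNorm u ^ 2)⁻¹ : ℂ)) • u) * Matrix.replicateRow Unit (star u)) := by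
    rw [← Matrix.vecMulVec_eq, Matrix.smul_vecMulVec, stretch, complProj, smul_sub, smul_add,
      smul_smul, smul_smul, sub_sub_cancel, sub_add, ← sub_smul, sub_eq_add_neg, ← neg_smul]
    congr 2
    field_simp
    ring
  rw [h, Matrix.det_smul, Matrix.det_one_add_replicateCol_mul_replicateRow, dotProduct_smul,
    star_dotProduct_self, Fintype.card_fin, smul_eq_mul]
  field_simp
  ring

/-- Stretching by `√(1 + v s)` off the line of `u` absorbs the exponent. The real determinant of a
complex-linear map is the squared modulus of its complex one, which removes the square root. The
value does not depend on `u`. -/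
theorem lintegral_exp_neg_mul_complProj {n : ℕ} {v s : ℝ} (hv : 0 < v) (hs : 0 ≤ s)
    {u : Fin (n + 1) → ℂ} (hu : u ≠ 0) :
    ∫⁻ h, ENNReal.ofReal (Real.exp (-(s * vecNorm (complProj u *ᵥ h) ^ 2)))
        ∂(Measure.pi fun _ : Fin (n + 1) => complexNormal v) =
      ENNReal.ofReal (((1 + v * s) ^ n)⁻¹) := by
  have h1 : 0 < 1 + v * s := by positivity
  have hdet : LinearMap.det ((Matrix.toLin' (stretch √(1 + v * s) u)).restrictScalars ℝ) =
      (1 + v * s) ^ n := by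
    rw [LinearMap.det_restrictScalars, LinearMap.det_toLin',
      det_stretch (Real.sqrt_pos.2 h1).ne' hu, map_pow, Algebra.norm_complex_apply,
      Complex.normSq_ofReal, Real.mul_self_sqrt h1.le]
  rw [lintegral_exp_neg_pi_complexNormal hv
    ((Matrix.toLin' (stretch √(1 + v * s) u)).restrictScalars ℝ) _ _ _, hdet,
    abs_of_nonneg (by positivity)]
  · rw [hdet]; positivity
  · intro h
    rw [LinearMap.restrictScalars_apply, Matrix.toLin'_apply, ← vecNorm_sq, vecNorm_stretch,
      ← vecNorm_sq, Real.sq_sqrt h1.le]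
    ring

theorem lintegral_exp_neg_mul_vecNorm {n : ℕ} {v s : ℝ} (hv : 0 < v) (hs : 0 ≤ s) :
    ∫⁻ h, ENNReal.ofReal (Real.exp (-(s * vecNorm h ^ 2)))
        ∂(Measure.pi fun _ : Fin n => complexNormal v) =
      ENNReal.ofReal (((1 + v * s) ^ n)⁻¹) := by
  have h1 : 0 < 1 + v * s := by positivity
  have hdet : LinearMap.det (√(1 + v * s) • (LinearMap.id : (Fin n → ℂ) →ₗ[ℝ] _)) =
      (1 + v * s) ^ n := by
    rw [LinearMap.det_smul, LinearMap.det_id, mul_one, Module.finrank_pi_fintype]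
    simp [Complex.finrank_real_complex, mul_comm n, pow_mul, Real.sq_sqrt h1.le]
  rw [lintegral_exp_neg_pi_complexNormal hv
    (√(1 + v * s) • (LinearMap.id : (Fin n → ℂ) →ₗ[ℝ] _)) _ _ _, hdet,
    abs_of_nonneg (by positivity)]
  · rw [hdet]; positivity
  · intro h
    simp only [LinearMap.smul_apply, LinearMap.id_apply, Pi.smul_apply, norm_smul, mul_pow,
      Real.norm_eq_abs, sq_abs, Real.sq_sqrt h1.le, ← Finset.mul_sum, vecNorm_sq]
    ring

/-! ### Beamforming: the success threshold and the zero-forcing gain. -/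

theorem norm_dotProduct_mrt_sq {Nt : ℕ} (hed : Fin Nt → ℂ) :
    ‖hed ⬝ᵥ mrt hed‖ ^ 2 = vecNorm hed ^ 2 := by
  rw [mrt, dotProduct_smul, dotProduct_comm, star_dotProduct_self, smul_eq_mul]
  by_cases h : vecNorm hed = 0
  -- For `h_ed = 0` the beamformer is `0` too, as `0⁻¹ = 0`, and both sides vanish.
  · simp [h]
  · have : (vecNorm hed : ℂ) ≠ 0 := by exact_mod_cast h
    rw [sq (vecNorm hed : ℂ), inv_mul_cancel_left₀ this, Complex.norm_real, Real.norm_eq_abs,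
      sq_abs]

/-- Under MRT with a receive vector that nulls the jamming, the eavesdropper succeeds iff
`|h_sd|²` does not exceed the threshold `|w† h_se|² (P_J ‖h_ed‖² + N_D) / N_E`. -/
theorem eavesdropX_mrt_of_orthogonal {Nt Nr : ℕ} {PS PJ ρ ND NE : ℝ} (hPS : 0 < PS) (hPJ : 0 < PJ)
    (hND : 0 < ND) (hNE : 0 < NE) (hsd : ℂ) (hed : Fin Nt → ℂ) (hse : Fin Nr → ℂ)
    (Hee : Matrix (Fin Nr) (Fin Nt) ℂ) (w : Fin Nr → ℂ) {S : ℝ}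
    (hw : star w ⬝ᵥ (Hee *ᵥ star hed) = 0) (hS : ‖star w ⬝ᵥ hse‖ ^ 2 = S) :
    eavesdropX PS PJ ρ ND NE hsd hed hse Hee (mrt hed) w =
      if S * ((PJ * vecNorm hed ^ 2 + ND) / NE) < ‖hsd‖ ^ 2 then 0 else 1 := by
  have h0 : star w ⬝ᵥ (Hee *ᵥ mrt hed) = 0 := by
    rw [mrt, Matrix.mulVec_smul, dotProduct_smul, hw, smul_zero]
  have hD : 0 < PJ * vecNorm hed ^ 2 + ND := by positivity
  rw [eavesdropX, sinrE, sinrD, h0, norm_dotProduct_mrt_sq, hS]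
  have : PS * S / (ρ * PJ * ‖(0 : ℂ)‖ ^ 2 + NE) < PS * ‖hsd‖ ^ 2 / (PJ * vecNorm hed ^ 2 + ND) ↔
      S * ((PJ * vecNorm hed ^ 2 + ND) / NE) < ‖hsd‖ ^ 2 := by
    rw [norm_zero, zero_pow two_ne_zero, mul_zero, zero_add, div_lt_div_iff₀ hNE hD,
      mul_div_assoc', div_lt_iff₀ hNE, mul_assoc, mul_assoc, mul_lt_mul_iff_right₀ hPS]
  simp only [ge_iff_le, ← not_lt, this, ite_not]

theorem rzf_orthogonal {Nt Nr : ℕ} (hed : Fin Nt → ℂ) (hse : Fin Nr → ℂ)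
    (Hee : Matrix (Fin Nr) (Fin Nt) ℂ) : star (rzf hed hse Hee) ⬝ᵥ (Hee *ᵥ star hed) = 0 := by
  rw [rzf, rzfProj_eq_complProj, star_smul, smul_dotProduct,
    star_dotProduct_comm_eq_zero (star_dotProduct_complProj_mulVec _ _), smul_zero]

/-- This needs no exceptional set: if `Π₂ h_se = 0`, the closed form degenerates to the zero vector,
whose gain `0` is still the right value. -/
theorem rzf_gain {Nt Nr : ℕ} (hed : Fin Nt → ℂ) (hse : Fin Nr → ℂ)
    (Hee : Matrix (Fin Nr) (Fin Nt) ℂ) :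
    ‖star (rzf hed hse Hee) ⬝ᵥ hse‖ ^ 2 =
      vecNorm (complProj (Hee *ᵥ star hed) *ᵥ hse) ^ 2 := by
  rw [← star_dotProduct_complProj_of_orthogonal hse (rzf_orthogonal hed hse Hee), rzf,
    rzfProj_eq_complProj, star_smul, smul_dotProduct, star_dotProduct_self, smul_eq_mul]
  set p := complProj (Hee *ᵥ star hed) *ᵥ hse
  by_cases h : vecNorm p = 0
  · simp [h]
  · have h' : (vecNorm p : ℂ) ≠ 0 := by exact_mod_cast h
    rw [norm_mul, norm_star, norm_inv, norm_pow, Complex.norm_real, Real.norm_eq_abs, mul_pow,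
      inv_pow, sq_abs]
    field_simp

/-- A feasible `w` sees only the projection of `h_se`; Cauchy–Schwarz does the rest. -/
theorem gain_le_of_mem_rzfFeasible {Nt Nr : ℕ} {hed : Fin Nt → ℂ}
    {Hee : Matrix (Fin Nr) (Fin Nt) ℂ} (hse : Fin Nr → ℂ) {w : Fin Nr → ℂ}
    (hw : w ∈ rzfFeasible hed Hee) :
    ‖star w ⬝ᵥ hse‖ ^ 2 ≤ vecNorm (complProj (Hee *ᵥ star hed) *ᵥ hse) ^ 2 := by
  rw [← star_dotProduct_complProj_of_orthogonal hse hw.1]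
  refine pow_le_pow_left₀ (norm_nonneg _) ?_ 2
  simpa [hw.2] using norm_star_dotProduct_le w (complProj (Hee *ᵥ star hed) *ᵥ hse)

/-- The gain of any optimal zero-forcing receive vector. -/
theorem IsRZF.gain {Nt Nr : ℕ} {hed : Fin Nt → ℂ} {hse : Fin Nr → ℂ}
    {Hee : Matrix (Fin Nr) (Fin Nt) ℂ} {w : Fin Nr → ℂ} (hw : IsRZF hed hse Hee w) :
    ‖star w ⬝ᵥ hse‖ ^ 2 = vecNorm (complProj (Hee *ᵥ star hed) *ᵥ hse) ^ 2 := by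
  refine le_antisymm (gain_le_of_mem_rzfFeasible hse hw.1) ?_
  by_cases h : vecNorm (complProj (Hee *ᵥ star hed) *ᵥ hse) = 0
  -- Here `rzf` is not a unit vector and cannot serve as a competitor, but the bound is trivial.
  · rw [h, zero_pow two_ne_zero]; positivity
  · have hf : rzf hed hse Hee ∈ rzfFeasible hed Hee := by
      refine ⟨rzf_orthogonal hed hse Hee, ?_⟩
      rw [rzf, rzfProj_eq_complProj, vecNorm_smul, norm_inv, Complex.norm_real, Real.norm_eq_abs,
        abs_of_nonneg (vecNorm_nonneg _), inv_mul_cancel₀ h]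
    have := hw.2 hf
    simp only [Set.mem_ofPred_eq] at this
    rwa [rzf_gain] at this

/-! ### The joint channel law and almost sure nondegeneracy. -/

/-- The joint law of `(h_sd, h_ed, h_se, H_ee)`. -/
noncomputable def channelLaw (Nt Nr : ℕ) (lam1 lam2 lam3 lam4 : ℝ) :
    Measure (ℂ × (Fin Nt → ℂ) × (Fin Nr → ℂ) × (Fin Nr × Fin Nt → ℂ)) :=
  (complexNormal lam1).prod ((Measure.pi fun _ => complexNormal lam3).prod
    ((Measure.pi fun _ => complexNormal lam2).prod (Measure.pi fun _ => complexNormal lam4)))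

instance (Nt Nr : ℕ) (lam1 lam2 lam3 lam4 : ℝ) :
    IsProbabilityMeasure (channelLaw Nt Nr lam1 lam2 lam3 lam4) := by
  unfold channelLaw; infer_instance

theorem hasLaw_channelLaw {Ω : Type*} [MeasurableSpace Ω] {P : Measure Ω} {Nt Nr : ℕ}
    {lam1 lam2 lam3 lam4 : ℝ} {hsd : Ω → ℂ} {hed : Ω → Fin Nt → ℂ} {hse : Ω → Fin Nr → ℂ}
    {Hee : Ω → Matrix (Fin Nr) (Fin Nt) ℂ}
    (hsd_law : HasLaw hsd (complexNormal lam1) P)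
    (hse_law : ∀ i, HasLaw (fun ω => hse ω i) (complexNormal lam2) P)
    (hed_law : ∀ j, HasLaw (fun ω => hed ω j) (complexNormal lam3) P)
    (Hee_law : ∀ i j, HasLaw (fun ω => Hee ω i j) (complexNormal lam4) P)
    (hindep : iIndepFun (channelCoeff hsd hed hse Hee) P) :
    HasLaw (fun ω => (hsd ω, hed ω, hse ω, fun p : Fin Nr × Fin Nt => Hee ω p.1 p.2))
      (channelLaw Nt Nr lam1 lam2 lam3 lam4) P := by
  set ν : ChannelIndex Nt Nr → Measure ℂ := fun i => match i with
    | .inl _ => complexNormal lam1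
    | .inr (.inl _) => complexNormal lam3
    | .inr (.inr (.inl _)) => complexNormal lam2
    | .inr (.inr (.inr _)) => complexNormal lam4 with hν
  have hlaw : ∀ i, HasLaw (channelCoeff hsd hed hse Hee i) (ν i) P := by
    rintro (_ | j | i | ⟨i, j⟩)
    exacts [hsd_law, hed_law j, hse_law i, Hee_law i j]
  have hprob : ∀ i, IsProbabilityMeasure (ν i) := by
    rintro (_ | j | i | ⟨i, j⟩) <;> simp only [hν] <;> infer_instance
  have hjoint : HasLaw (fun ω i => channelCoeff hsd hed hse Hee i ω) (Measure.pi ν) P :=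
    ⟨aemeasurable_pi_lambda _ fun i => (hlaw i).aemeasurable, by
      rw [hindep.map_fun_eq_pi_map fun i => (hlaw i).aemeasurable]
      congr 1; ext1 i; exact (hlaw i).map_eq⟩
  -- Splitting the nested sum of indices block by block turns the product over all coefficients into
  -- the four-fold product.
  have m1 := measurePreserving_sumPiEquivProdPi ν
  have m2 := measurePreserving_sumPiEquivProdPi fun i => ν (.inr i)
  have m3 := measurePreserving_sumPiEquivProdPi fun i => ν (.inr (.inr i))
  have m0 := measurePreserving_funUnique (complexNormal lam1) Unit
  have m := (m0.prod (((MeasurePreserving.id _).prod m3).comp m2)).comp m1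
  exact m.comp_hasLaw hjoint

/-- Once the other coordinates are fixed, the equation determines `g 0`, and single points are null.
-/
theorem ae_pi_complexNormal_linear_ne_zero {n : ℕ} {v : ℝ} (hv : 0 < v) {r : Fin (n + 1) → ℂ}
    (hr : r 0 ≠ 0) :
    ∀ᵐ g ∂(Measure.pi fun _ : Fin (n + 1) => complexNormal v), r ⬝ᵥ star g ≠ 0 := by
  have mp := measurePreserving_piFinSuccAbove (fun _ : Fin (n + 1) => complexNormal v) 0
  have hm : MeasurableSet {p : ℂ × (Fin n → ℂ) |
      r 0 * star p.1 + ∑ j, r (Fin.succ j) * star (p.2 j) = 0} :=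
    measurableSet_eq_fun (by fun_prop) measurable_const
  have h : ∀ᵐ p ∂((complexNormal v).prod (Measure.pi fun _ : Fin n => complexNormal v)),
      r 0 * star p.1 + ∑ j, r (Fin.succ j) * star (p.2 j) ≠ 0 := by
    rw [ae_iff]
    simp only [ne_eq, not_not]
    rw [Measure.prod_apply_symm hm]
    refine (lintegral_congr fun y => ?_).trans lintegral_zero
    refine measure_mono_null (t := {star (-(∑ j, r (Fin.succ j) * star (y j)) / r 0)})
      (fun z hz => ?_) (complexNormal_singleton hv _)
    have hz : r 0 * star z + ∑ j, r (Fin.succ j) * star (y j) = 0 := hz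
    rw [Set.mem_singleton_iff, ← eq_neg_of_add_eq_zero_left hz, mul_div_cancel_left₀ _ hr,
      star_star]
  filter_upwards [mp.quasiMeasurePreserving.ae h] with g hg
  rwa [dotProduct, Fin.sum_univ_succ]

/-- After exchanging the quantifiers it suffices to look at the first row of a fixed `H` with `H (0,
0) ≠ 0`, a nonzero form in `star g`. -/
theorem ae_ae_mulVec_ne_zero {m n : ℕ} {v w : ℝ} (hv : 0 < v) (hw : 0 < w) :
    ∀ᵐ g ∂(Measure.pi fun _ : Fin (n + 1) => complexNormal v),
      ∀ᵐ H ∂(Measure.pi fun _ : Fin (m + 1) × Fin (n + 1) => complexNormal w),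
        Matrix.of (fun i j => H (i, j)) *ᵥ star g ≠ 0 := by
  rw [Measure.ae_ae_comm]
  · have h0 : ∀ᵐ H ∂(Measure.pi fun _ : Fin (m + 1) × Fin (n + 1) => complexNormal w),
        H (0, 0) ≠ 0 := by
      have : ∀ᵐ z ∂(complexNormal w), z ≠ 0 := by
        rw [ae_iff]; simpa using complexNormal_singleton hw 0
      exact (measurePreserving_eval (fun _ : Fin (m + 1) × Fin (n + 1) => complexNormal w)
        (0, 0)).quasiMeasurePreserving.ae this
    filter_upwards [h0] with H hH
    filter_upwards [ae_pi_complexNormal_linear_ne_zero (r := fun j => H (0, j)) hv hH] with g hg h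
    exact hg (congrFun h 0)
  · have hmeas : Measurable fun x : (Fin (n + 1) → ℂ) × (Fin (m + 1) × Fin (n + 1) → ℂ) =>
        Matrix.of (fun i j => x.2 (i, j)) *ᵥ star x.1 := by
      refine measurable_pi_lambda _ fun i => ?_
      simp only [Matrix.mulVec, dotProduct, Matrix.of_apply, Pi.star_apply]
      fun_prop
    exact ((measurableSet_singleton (0 : Fin (m + 1) → ℂ)).preimage hmeas).compl

/-! ### The law of the zero-forcing gain and the outage event. -/

/-- The squared norm of `Π₂ h_se` as a function of `h_ed`, `h_se` and the entries of `H_ee`. -/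
noncomputable def zfGain {Nt Nr : ℕ}
    (x : (Fin Nt → ℂ) × (Fin Nr → ℂ) × (Fin Nr × Fin Nt → ℂ)) : ℝ :=
  vecNorm (complProj (Matrix.of (fun i j => x.2.2 (i, j)) *ᵥ star x.1) *ᵥ x.2.1) ^ 2

theorem zfGain_nonneg {Nt Nr : ℕ}
    (x : (Fin Nt → ℂ) × (Fin Nr → ℂ) × (Fin Nr × Fin Nt → ℂ)) : 0 ≤ zfGain x :=
  sq_nonneg _

theorem measurable_zfGain {Nt Nr : ℕ} : Measurable (zfGain (Nt := Nt) (Nr := Nr)) := by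
  unfold zfGain
  simp only [complProj_mulVec, vecNorm_sq, ← Complex.ofReal_pow, Matrix.mulVec, dotProduct,
    Matrix.of_apply, Pi.star_apply, Pi.sub_apply, Pi.smul_apply, smul_eq_mul]
  fun_prop

theorem measurable_vecNorm {n : ℕ} : Measurable (vecNorm (n := n)) := by
  unfold vecNorm; fun_prop

/-- The Laplace transform of the zero-forcing gain `S`, at a point that depends on `h_ed`. -/
theorem lintegral_exp_neg_mul_zfGain {m n : ℕ} {lam2 lam3 lam4 : ℝ} (h2 : 0 < lam2)
    (h3 : 0 < lam3) (h4 : 0 < lam4) {c : (Fin (n + 1) → ℂ) → ℝ} (hc : Measurable c)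
    (hc0 : ∀ g, 0 ≤ c g) :
    ∫⁻ x, ENNReal.ofReal (Real.exp (-(c x.1 * zfGain x)))
        ∂((Measure.pi fun _ : Fin (n + 1) => complexNormal lam3).prod
          ((Measure.pi fun _ : Fin (m + 1) => complexNormal lam2).prod
            (Measure.pi fun _ : Fin (m + 1) × Fin (n + 1) => complexNormal lam4))) =
      ∫⁻ g, ENNReal.ofReal (((1 + lam2 * c g) ^ m)⁻¹)
        ∂(Measure.pi fun _ : Fin (n + 1) => complexNormal lam3) := by
  have hm : Measurable fun x : (Fin (n + 1) → ℂ) × (Fin (m + 1) → ℂ) ×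
      (Fin (m + 1) × Fin (n + 1) → ℂ) => ENNReal.ofReal (Real.exp (-(c x.1 * zfGain x))) :=
    (((hc.comp measurable_fst).mul measurable_zfGain).neg.exp).ennreal_ofReal
  rw [lintegral_prod _ hm.aemeasurable]
  refine lintegral_congr_ae ?_
  filter_upwards [ae_ae_mulVec_ne_zero (m := m) (n := n) h3 h4] with g hg
  have hm' : Measurable fun y : (Fin (m + 1) → ℂ) × (Fin (m + 1) × Fin (n + 1) → ℂ) =>
      ENNReal.ofReal (Real.exp (-(c g * zfGain (g, y)))) := hm.comp measurable_prodMk_left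
  refine (lintegral_prod_symm _ hm'.aemeasurable).trans ?_
  -- For almost every `H` the nulled direction is nonzero, so the integral over `h_se` does not
  -- depend on `H`.
  have : ∀ᵐ H ∂(Measure.pi fun _ : Fin (m + 1) × Fin (n + 1) => complexNormal lam4),
      ∫⁻ h, ENNReal.ofReal (Real.exp (-(c g * zfGain (g, h, H))))
        ∂(Measure.pi fun _ : Fin (m + 1) => complexNormal lam2) =
      ENNReal.ofReal (((1 + lam2 * c g) ^ m)⁻¹) := by
    filter_upwards [hg] with H hH
    have := lintegral_exp_neg_mul_complProj h2 (hc0 g) hH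
    simpa only [zfGain] using this
  rw [lintegral_congr_ae this, lintegral_const, measure_univ, mul_one]

theorem measurableSet_outage {Nt Nr : ℕ} {c : (Fin Nt → ℂ) → ℝ} (hc : Measurable c) :
    MeasurableSet {x : ℂ × (Fin Nt → ℂ) × (Fin Nr → ℂ) × (Fin Nr × Fin Nt → ℂ) |
      zfGain x.2 * c x.2.1 < ‖x.1‖ ^ 2} :=
  measurableSet_lt ((measurable_zfGain.comp measurable_snd).mul
    (hc.comp (measurable_fst.comp measurable_snd))) (by fun_prop)

/-- Integrating out `h_sd` first replaces the event by its exponential tail, a Laplace transform of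
the gain at `c / lam1`. -/
theorem channelLaw_outage {m n : ℕ} {lam1 lam2 lam3 lam4 : ℝ} (h1 : 0 < lam1) (h2 : 0 < lam2)
    (h3 : 0 < lam3) (h4 : 0 < lam4) {c : (Fin (n + 1) → ℂ) → ℝ} (hc : Measurable c)
    (hc0 : ∀ g, 0 ≤ c g) :
    channelLaw (n + 1) (m + 1) lam1 lam2 lam3 lam4 {x | zfGain x.2 * c x.2.1 < ‖x.1‖ ^ 2} =
      ∫⁻ g, ENNReal.ofReal (((1 + lam2 * (c g / lam1)) ^ m)⁻¹)
        ∂(Measure.pi fun _ : Fin (n + 1) => complexNormal lam3) := by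
  rw [channelLaw, Measure.prod_apply_symm (measurableSet_outage hc),
    ← lintegral_exp_neg_mul_zfGain (m := m) h2 h3 h4 (hc.div_const lam1)
      fun g => div_nonneg (hc0 g) h1.le]
  refine lintegral_congr fun y => ?_
  refine (complexNormal_tail h1 (mul_nonneg (zfGain_nonneg y) (hc0 y.1))).trans ?_
  congr 2
  ring

/-! ### Inverse moments and incomplete gamma functions. -/

theorem integral_pow_div_factorial_mul_exp_neg (p : ℕ) {y : ℝ} (hy : 0 < y) :
    ∫ x in Set.Ioi (0 : ℝ), x ^ p / (p ! : ℝ) * Real.exp (-(y * x)) = (y ^ (p + 1))⁻¹ := by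
  have h := Real.integral_rpow_mul_exp_neg_mul_Ioi (a := p + 1) (r := y) (by positivity) hy
  simp only [add_sub_cancel_right, Real.rpow_natCast, Real.Gamma_nat_eq_factorial] at h
  have : ∀ x : ℝ, x ^ p / (p ! : ℝ) * Real.exp (-(y * x)) =
      (p ! : ℝ)⁻¹ * (x ^ p * Real.exp (-(y * x))) := fun x => by ring
  simp only [this]
  rw [integral_const_mul, h]
  have h0 : (p ! : ℝ) ≠ 0 := by positivity
  rw [← Nat.cast_succ, Real.rpow_natCast, one_div, inv_pow]
  field_simp

theorem lintegral_pow_div_factorial_mul_exp_neg (p : ℕ) {y : ℝ} (hy : 0 < y) :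
    ∫⁻ x in Set.Ioi (0 : ℝ), ENNReal.ofReal (x ^ p / (p ! : ℝ) * Real.exp (-(y * x))) =
      ENNReal.ofReal ((y ^ (p + 1))⁻¹) := by
  have h := integral_pow_div_factorial_mul_exp_neg p hy
  rw [← h, ofReal_integral_eq_lintegral_ofReal]
  · exact Integrable.of_integral_ne_zero (by rw [h]; positivity)
  · refine (ae_restrict_iff' measurableSet_Ioi).2 (ae_of_all _ fun x hx => ?_)
    have : 0 < x := hx
    positivity

/-- The inverse moments of `‖g‖² / v + β` are those of a shifted Gamma variable of shape
`n + 1`. -/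
theorem lintegral_inv_vecNorm_add_pow {n p : ℕ} {v β : ℝ} (hv : 0 < v) (hβ : 0 < β) :
    ∫⁻ g, ENNReal.ofReal (((vecNorm g ^ 2 / v + β) ^ (p + 1))⁻¹)
        ∂(Measure.pi fun _ : Fin (n + 1) => complexNormal v) =
      ∫⁻ t in Set.Ioi (0 : ℝ), ENNReal.ofReal (t ^ n / (n ! : ℝ) * Real.exp (-t) *
        ((t + β) ^ (p + 1))⁻¹) := by
  set w : ℝ → ENNReal := fun x => ENNReal.ofReal (x ^ p / (p ! : ℝ) * Real.exp (-(β * x)))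
    with hw
  have hwm : Measurable w := by fun_prop
  have hexp : ∀ {x a : ℝ}, 0 ≤ x → ENNReal.ofReal (x ^ p / (p ! : ℝ) * Real.exp (-((a + β) * x))) =
      w x * ENNReal.ofReal (Real.exp (-(x * a))) := fun {x a} hx => by
    rw [hw, ← ENNReal.ofReal_mul (by positivity), mul_assoc, ← Real.exp_add]
    congr 3; ring
  have hvm := measurable_vecNorm (n := n + 1)
  -- Both sides are reduced to one integral: the inverse power becomes a mixture of exponentials,
  -- and after Tonelli only the Laplace transform `(1 + x)^(-(n + 1))` enters. The density of `‖g‖²`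
  -- is never needed.
  have hL : ∫⁻ g, ENNReal.ofReal (((vecNorm g ^ 2 / v + β) ^ (p + 1))⁻¹)
        ∂(Measure.pi fun _ : Fin (n + 1) => complexNormal v) =
      ∫⁻ x in Set.Ioi (0 : ℝ), w x * ENNReal.ofReal (((1 + x) ^ (n + 1))⁻¹) := by
    calc _ = ∫⁻ g, (∫⁻ x in Set.Ioi (0 : ℝ),
          w x * ENNReal.ofReal (Real.exp (-(x * (vecNorm g ^ 2 / v)))))
          ∂(Measure.pi fun _ : Fin (n + 1) => complexNormal v) := by
          refine lintegral_congr fun g => ?_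
          rw [← lintegral_pow_div_factorial_mul_exp_neg p (by positivity)]
          exact setLIntegral_congr_fun measurableSet_Ioi fun x hx => hexp (le_of_lt hx)
      _ = ∫⁻ x in Set.Ioi (0 : ℝ), ∫⁻ g,
          w x * ENNReal.ofReal (Real.exp (-(x * (vecNorm g ^ 2 / v))))
          ∂(Measure.pi fun _ : Fin (n + 1) => complexNormal v) :=
          lintegral_lintegral_swap (by fun_prop)
      _ = _ := by
          refine setLIntegral_congr_fun measurableSet_Ioi fun x hx => ?_
          have hx : 0 < x := hx
          rw [lintegral_const_mul _ (by fun_prop)]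
          have := lintegral_exp_neg_mul_vecNorm (n := n + 1) (s := x / v) hv (by positivity)
          rw [mul_div_cancel₀ _ hv.ne'] at this
          rw [← this]
          congr 1
          refine lintegral_congr fun g => ?_
          congr 3; ring
  have hR : ∫⁻ t in Set.Ioi (0 : ℝ), ENNReal.ofReal (t ^ n / (n ! : ℝ) * Real.exp (-t) *
        ((t + β) ^ (p + 1))⁻¹) =
      ∫⁻ x in Set.Ioi (0 : ℝ), w x * ENNReal.ofReal (((1 + x) ^ (n + 1))⁻¹) := by
    calc _ = ∫⁻ t in Set.Ioi (0 : ℝ), ∫⁻ x in Set.Ioi (0 : ℝ),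
          w x * ENNReal.ofReal (t ^ n / (n ! : ℝ) * Real.exp (-((1 + x) * t))) := by
          refine setLIntegral_congr_fun measurableSet_Ioi fun t ht => ?_
          have ht : 0 < t := ht
          rw [ENNReal.ofReal_mul (by positivity),
            ← lintegral_pow_div_factorial_mul_exp_neg p (by positivity),
            ← lintegral_const_mul _ (by fun_prop)]
          refine setLIntegral_congr_fun measurableSet_Ioi fun x hx => ?_
          rw [hexp (le_of_lt hx), mul_left_comm, ← ENNReal.ofReal_mul (by positivity), mul_assoc,
            ← Real.exp_add]
          congr 4; ring
      _ = ∫⁻ x in Set.Ioi (0 : ℝ), ∫⁻ t in Set.Ioi (0 : ℝ),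
          w x * ENNReal.ofReal (t ^ n / (n ! : ℝ) * Real.exp (-((1 + x) * t))) :=
          lintegral_lintegral_swap (by fun_prop)
      _ = _ := by
          refine setLIntegral_congr_fun measurableSet_Ioi fun x hx => ?_
          have hx : 0 < x := hx
          rw [lintegral_const_mul _ (by fun_prop),
            lintegral_pow_div_factorial_mul_exp_neg n (by positivity)]
  rw [hL, hR]

/-- Since `x > 0` keeps the singularity at `0` away, `s` may have either sign. -/
theorem integrableOn_upperGamma (s : ℝ) {x : ℝ} (hx : 0 < x) :
    IntegrableOn (fun t : ℝ => t ^ (s - 1) * Real.exp (-t)) (Set.Ioi x) := by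
  refine integrable_of_isBigO_exp_neg (b := 1 / 2) (by norm_num) ?_ ?_
  · exact (continuousOn_id.rpow_const fun t ht => .inl (hx.trans_le ht).ne').mul
      (by fun_prop)
  · simpa only [mul_comm] using (Real.Gamma_integrand_isLittleO (s - 1)).isBigO

/-- The coefficients of `upperGamma` in the outage probability. -/
noncomputable def gammaCoeff (n k : ℕ) (β : ℝ) : ℝ :=
  (-1 : ℝ) ^ k / ((k ! : ℝ) * ((n - k)! : ℝ)) * β ^ k * Real.exp β

/-- Binomial expansion of `(t - β) ^ n`. The exponents left after dividing by `t ^ p` may be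
negative, hence the real powers. -/
theorem shifted_integrand_eq_sum {n p : ℕ} {β t : ℝ} (ht : 0 < t) :
    (t - β) ^ n / (n ! : ℝ) * Real.exp (-(t - β)) * (t ^ p)⁻¹ =
      ∑ k ∈ Finset.range (n + 1),
        gammaCoeff n k β * (t ^ (((n : ℝ) - p - k + 1) - 1) * Real.exp (-t)) := by
  rw [neg_sub, sub_eq_add_neg, sub_eq_add_neg, Real.exp_add, add_comm t, add_pow, Finset.sum_div,
    Finset.sum_mul, Finset.sum_mul]
  refine Finset.sum_congr rfl fun k hk => ?_
  have hk : k ≤ n := Nat.lt_succ_iff.1 (Finset.mem_range.1 hk)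
  have hpow : t ^ (((n : ℝ) - p - k + 1) - 1) = t ^ (n - k) * (t ^ p)⁻¹ := by
    rw [← Real.rpow_natCast, ← Real.rpow_natCast, ← Real.rpow_neg ht.le, ← Real.rpow_add ht,
      Nat.cast_sub hk]
    congr 1; ring
  rw [hpow, gammaCoeff, Nat.cast_choose ℝ hk, neg_pow]
  have h1 : (n ! : ℝ) ≠ 0 := by positivity
  have h2 : (k ! : ℝ) ≠ 0 := by positivity
  have h3 : ((n - k)! : ℝ) ≠ 0 := by positivity
  field_simp

theorem lintegral_gamma_inv_pow {n p : ℕ} {β : ℝ} (hβ : 0 < β) :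
    ∫⁻ t in Set.Ioi (0 : ℝ), ENNReal.ofReal (t ^ n / (n ! : ℝ) * Real.exp (-t) *
        ((t + β) ^ p)⁻¹) =
      ENNReal.ofReal (∑ k ∈ Finset.range (n + 1),
        gammaCoeff n k β * upperGamma ((n : ℝ) - p - k + 1) β) := by
  have hint : ∀ k ∈ Finset.range (n + 1), IntegrableOn (fun t : ℝ => gammaCoeff n k β *
      (t ^ (((n : ℝ) - p - k + 1) - 1) * Real.exp (-t))) (Set.Ioi β) := fun k _ =>
    (integrableOn_upperGamma _ hβ).const_mul _
  have hpre : (fun t : ℝ => t + β) ⁻¹' Set.Ioi β = Set.Ioi 0 := by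
    ext t; simp
  have hshift := (measurePreserving_add_right volume β).setLIntegral_comp_preimage
    (s := Set.Ioi β) (f := fun t => ENNReal.ofReal ((t - β) ^ n / (n ! : ℝ) *
      Real.exp (-(t - β)) * (t ^ p)⁻¹)) measurableSet_Ioi (by fun_prop)
  simp only [hpre, add_sub_cancel_right] at hshift
  rw [hshift]
  simp only [upperGamma]
  simp only [← integral_const_mul]
  rw [← integral_finsetSum _ hint, ofReal_integral_eq_lintegral_ofReal
    (integrable_finsetSum _ hint)]
  · exact setLIntegral_congr_fun measurableSet_Ioi fun t ht => by
      simp only [shifted_integrand_eq_sum (hβ.trans ht)]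
  · refine (ae_restrict_iff' measurableSet_Ioi).2 (ae_of_all _ fun t ht => ?_)
    have h1 : 0 < t := hβ.trans ht
    have h2 : 0 ≤ t - β := sub_nonneg.2 (le_of_lt ht)
    simp only [Pi.zero_apply, ← shifted_integrand_eq_sum h1]
    positivity

/-! ### Assembling the closed form. -/

theorem mrtRzfValue_eq_one_sub (n p : ℕ) (lam1 lam2 lam3 PJ ND NE : ℝ) :
    mrtRzfValue (n + 1) (p + 2) lam1 lam2 lam3 PJ ND NE =
      1 - (lam1 * NE / (lam2 * lam3 * PJ)) ^ (p + 1) * ∑ k ∈ Finset.range (n + 1),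
        gammaCoeff n k (ND / (lam3 * PJ) + lam1 * NE / (lam2 * lam3 * PJ)) *
          upperGamma ((n : ℝ) - (p + 1 : ℕ) - k + 1)
            (ND / (lam3 * PJ) + lam1 * NE / (lam2 * lam3 * PJ)) := by
  rw [mrtRzfValue, Finset.mul_sum]
  congr 1
  refine Finset.sum_congr rfl fun k _ => ?_
  rw [show n + 1 - k - 1 = n - k by omega, show p + 2 - 1 = p + 1 by omega, gammaCoeff,
    show ((n + 1 : ℕ) : ℝ) - ((p + 2 : ℕ) : ℝ) - k + 1 = (n : ℝ) - (p + 1 : ℕ) - k + 1 by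
      push_cast; ring]
  ring

theorem channelLaw_outage_eq {n p : ℕ} {lam1 lam2 lam3 lam4 PJ ND NE : ℝ}
    (h1 : 0 < lam1) (h2 : 0 < lam2) (h3 : 0 < lam3) (h4 : 0 < lam4) (hPJ : 0 < PJ) (hND : 0 < ND)
    (hNE : 0 < NE) :
    (channelLaw (n + 1) (p + 2) lam1 lam2 lam3 lam4).real
        {x | zfGain x.2 * ((PJ * vecNorm x.2.1 ^ 2 + ND) / NE) < ‖x.1‖ ^ 2} =
      1 - mrtRzfValue (n + 1) (p + 2) lam1 lam2 lam3 PJ ND NE := by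
  set θ := lam1 * NE / (lam2 * lam3 * PJ) with hθ
  set β := ND / (lam3 * PJ) + θ with hβ
  have hθ0 : 0 < θ := by positivity
  have hβ0 : 0 < β := by positivity
  have hvm := measurable_vecNorm (n := n + 1)
  have hE := channelLaw_outage (m := p + 1) (n := n) h1 h2 h3 h4
    (c := fun g => (PJ * vecNorm g ^ 2 + ND) / NE) (by fun_prop) (fun g => by positivity)
  have hI : ∀ g : Fin (n + 1) → ℂ, ENNReal.ofReal
      (((1 + lam2 * ((PJ * vecNorm g ^ 2 + ND) / NE / lam1)) ^ (p + 1))⁻¹) =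
      ENNReal.ofReal (θ ^ (p + 1)) *
        ENNReal.ofReal (((vecNorm g ^ 2 / lam3 + β) ^ (p + 1))⁻¹) := fun g => by
    -- Pulling out `θ⁻¹` normalizes the coefficient of `‖g‖² / lam3` to `1`; the constant term
    -- becomes `β = ND / (lam3 * PJ) + θ`.
    have : 1 + lam2 * ((PJ * vecNorm g ^ 2 + ND) / NE / lam1) =
        (vecNorm g ^ 2 / lam3 + β) / θ := by
      rw [hβ, hθ]
      field_simp
      ring
    rw [this, div_pow, inv_div, div_eq_mul_inv, ENNReal.ofReal_mul (by positivity)]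
  have hM : channelLaw (n + 1) (p + 2) lam1 lam2 lam3 lam4
      {x | zfGain x.2 * ((PJ * vecNorm x.2.1 ^ 2 + ND) / NE) < ‖x.1‖ ^ 2} =
      ENNReal.ofReal (θ ^ (p + 1)) * ENNReal.ofReal (∑ k ∈ Finset.range (n + 1),
        gammaCoeff n k β * upperGamma ((n : ℝ) - (p + 1 : ℕ) - k + 1) β) := by
    refine hE.trans ?_
    rw [lintegral_congr hI, lintegral_const_mul _ (by fun_prop),
      lintegral_inv_vecNorm_add_pow h3 hβ0, lintegral_gamma_inv_pow hβ0]
  -- The sum alternates in sign; its nonnegativity is read off the integrand before expansion.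
  have hS : 0 ≤ ∑ k ∈ Finset.range (n + 1),
      gammaCoeff n k β * upperGamma ((n : ℝ) - (p + 1 : ℕ) - k + 1) β := by
    simp only [upperGamma, ← integral_const_mul]
    rw [← integral_finsetSum _ fun k _ => (integrableOn_upperGamma _ hβ0).const_mul _]
    refine setIntegral_nonneg measurableSet_Ioi fun t ht => ?_
    have ht0 : 0 < t := hβ0.trans ht
    have : 0 ≤ t - β := sub_nonneg.2 (le_of_lt ht)
    rw [← shifted_integrand_eq_sum ht0]
    positivity
  rw [measureReal_def, hM, ENNReal.toReal_mul, ENNReal.toReal_ofReal (by positivity),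
    ENNReal.toReal_ofReal hS, mrtRzfValue_eq_one_sub, sub_sub_cancel]

/-- Only orthogonality and the gain of `wr` matter. No measurability of `wr` is needed, because `X`
agrees almost surely with the indicator of a measurable event in the channel coefficients. -/
theorem integral_eavesdropX_mrt {Ω : Type*} [MeasurableSpace Ω] {P : Measure Ω}
    [IsProbabilityMeasure P] {n p : ℕ} {lam1 lam2 lam3 lam4 PS PJ ρ ND NE : ℝ}
    (h1 : 0 < lam1) (h2 : 0 < lam2) (h3 : 0 < lam3) (h4 : 0 < lam4) (hPS : 0 < PS)
    (hPJ : 0 < PJ) (hND : 0 < ND) (hNE : 0 < NE)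
    {hsd : Ω → ℂ} {hed : Ω → Fin (n + 1) → ℂ} {hse : Ω → Fin (p + 2) → ℂ}
    {Hee : Ω → Matrix (Fin (p + 2)) (Fin (n + 1)) ℂ}
    (hlaw : HasLaw (fun ω => (hsd ω, hed ω, hse ω,
        fun q : Fin (p + 2) × Fin (n + 1) => Hee ω q.1 q.2))
      (channelLaw (n + 1) (p + 2) lam1 lam2 lam3 lam4) P)
    {wr : Ω → Fin (p + 2) → ℂ}
    (hort : ∀ᵐ ω ∂P, star (wr ω) ⬝ᵥ (Hee ω *ᵥ star (hed ω)) = 0)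
    (hgain : ∀ᵐ ω ∂P, ‖star (wr ω) ⬝ᵥ hse ω‖ ^ 2 =
      vecNorm (complProj (Hee ω *ᵥ star (hed ω)) *ᵥ hse ω) ^ 2) :
    Integrable (fun ω => eavesdropX PS PJ ρ ND NE (hsd ω) (hed ω) (hse ω) (Hee ω)
        (mrt (hed ω)) (wr ω)) P ∧
      ∫ ω, eavesdropX PS PJ ρ ND NE (hsd ω) (hed ω) (hse ω) (Hee ω) (mrt (hed ω)) (wr ω) ∂P
        = mrtRzfValue (n + 1) (p + 2) lam1 lam2 lam3 PJ ND NE := by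
  set μ := channelLaw (n + 1) (p + 2) lam1 lam2 lam3 lam4
  set A : Set (ℂ × (Fin (n + 1) → ℂ) × (Fin (p + 2) → ℂ) × (Fin (p + 2) × Fin (n + 1) → ℂ)) :=
    {x | zfGain x.2 * ((PJ * vecNorm x.2.1 ^ 2 + ND) / NE) < ‖x.1‖ ^ 2} with hA
  have hvm := measurable_vecNorm (n := n + 1)
  have hAm : MeasurableSet A :=
    measurableSet_outage (c := fun g => (PJ * vecNorm g ^ 2 + ND) / NE) (by fun_prop)
  set F := Aᶜ.indicator (fun _ => (1 : ℝ)) with hF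
  have hFi : Integrable F μ := (integrable_const _).indicator hAm.compl
  have hae : (fun ω => eavesdropX PS PJ ρ ND NE (hsd ω) (hed ω) (hse ω) (Hee ω)
      (mrt (hed ω)) (wr ω)) =ᵐ[P] fun ω => F (hsd ω, hed ω, hse ω,
        fun q : Fin (p + 2) × Fin (n + 1) => Hee ω q.1 q.2) := by
    filter_upwards [hort, hgain] with ω ho hg
    rw [eavesdropX_mrt_of_orthogonal hPS hPJ hND hNE _ _ _ _ _ ho hg, hF, Set.indicator_apply]
    simp only [Set.mem_compl_iff, ite_not]
    rfl
  have hint : Integrable (fun ω => F (hsd ω, hed ω, hse ω,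
      fun q : Fin (p + 2) × Fin (n + 1) => Hee ω q.1 q.2)) P := by
    rw [← hlaw.map_eq] at hFi
    exact hFi.comp_aemeasurable hlaw.aemeasurable
  refine ⟨hint.congr hae.symm, ?_⟩
  rw [integral_congr_ae hae]
  have := integral_map hlaw.aemeasurable (f := F) (by rw [hlaw.map_eq]; exact hFi.1)
  rw [← this, hlaw.map_eq, hF, integral_indicator_const _ hAm.compl, smul_eq_mul, mul_one,
    probReal_compl_eq_one_sub hAm, channelLaw_outage_eq h1 h2 h3 h4 hPJ hND hNE, sub_sub_cancel]

theorem theorem7 {Ω : Type*} [MeasurableSpace Ω] (P : Measure Ω) [IsProbabilityMeasure P]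
    (Nt Nr : ℕ) (hNt : 1 ≤ Nt) (hNr : 1 < Nr)
    (lam1 lam2 lam3 lam4 PS PJ ρ ND NE : ℝ)
    (hlam1 : 0 < lam1) (hlam2 : 0 < lam2) (hlam3 : 0 < lam3) (hlam4 : 0 < lam4)
    (hPS : 0 < PS) (hPJ : 0 < PJ) (hρ0 : 0 ≤ ρ) (hρ1 : ρ ≤ 1) (hND : 0 < ND) (hNE : 0 < NE)
    (hsd : Ω → ℂ) (hed : Ω → Fin Nt → ℂ) (hse : Ω → Fin Nr → ℂ)
    (Hee : Ω → Matrix (Fin Nr) (Fin Nt) ℂ)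
    (hsd_law : HasLaw hsd (complexNormal lam1) P)
    (hse_law : ∀ i, HasLaw (fun ω => hse ω i) (complexNormal lam2) P)
    (hed_law : ∀ j, HasLaw (fun ω => hed ω j) (complexNormal lam3) P)
    (Hee_law : ∀ i j, HasLaw (fun ω => Hee ω i j) (complexNormal lam4) P)
    (hindep : iIndepFun (channelCoeff hsd hed hse Hee) P) :
    -- the scheme with the closed-form receive vector
    (Integrable (fun ω => eavesdropX PS PJ ρ ND NE (hsd ω) (hed ω) (hse ω) (Hee ω)
        (mrt (hed ω)) (rzf (hed ω) (hse ω) (Hee ω))) P ∧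
      ∫ ω, eavesdropX PS PJ ρ ND NE (hsd ω) (hed ω) (hse ω) (Hee ω)
        (mrt (hed ω)) (rzf (hed ω) (hse ω) (Hee ω)) ∂P
        = mrtRzfValue Nt Nr lam1 lam2 lam3 PJ ND NE) ∧
    -- the scheme with any solution of the zero-forcing problem as the receive vector
    (∀ wr : Ω → Fin Nr → ℂ, (∀ᵐ ω ∂P, IsRZF (hed ω) (hse ω) (Hee ω) (wr ω)) →
      Integrable (fun ω => eavesdropX PS PJ ρ ND NE (hsd ω) (hed ω) (hse ω) (Hee ω)
        (mrt (hed ω)) (wr ω)) P ∧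
      ∫ ω, eavesdropX PS PJ ρ ND NE (hsd ω) (hed ω) (hse ω) (Hee ω)
        (mrt (hed ω)) (wr ω) ∂P
        = mrtRzfValue Nt Nr lam1 lam2 lam3 PJ ND NE) := by
  obtain ⟨n, rfl⟩ : ∃ n, Nt = n + 1 := ⟨Nt - 1, by omega⟩
  -- With `Nr = p + 2` the exponent `Nr - 1 = p + 1` is positive, as the gamma representation of the
  -- inverse power requires.
  obtain ⟨p, rfl⟩ : ∃ p, Nr = p + 2 := ⟨Nr - 2, by omega⟩
  have hlaw := hasLaw_channelLaw hsd_law hse_law hed_law Hee_law hindep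
  refine ⟨integral_eavesdropX_mrt hlam1 hlam2 hlam3 hlam4 hPS hPJ hND hNE hlaw
    (ae_of_all _ fun ω => rzf_orthogonal _ _ _) (ae_of_all _ fun ω => rzf_gain _ _ _), ?_⟩
  intro wr hwr
  exact integral_eavesdropX_mrt hlam1 hlam2 hlam3 hlam4 hPS hPJ hND hNE hlaw
    (hwr.mono fun ω h => h.1.1) (hwr.mono fun ω h => h.gain)
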